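/- Let $\Sigma\subset\mathbb{R}^3$ be the image of the standard unit sphere $S^2$ under a smooth diffeomorphism of $\mathbb{R}^3$ onto itself, let $\Omega$ be the bounded open region enclosed by $\Sigma$, and let $\eta$ be the inward unit normal to $\Sigma$. For a normal vector $w$ to $\Sigma$ at a point, let $A_\Sigma^{w}(X,Y)=\langle w,\eta\rangle A_\Sigma^{\eta}(X,Y)$, where $A_\Sigma^\eta(X,Y)=-\langle D_X\eta,Y\rangle$, be the second fundamental form of $\Sigma$ in the direction $w$. Suppose that $\Sigma$ is strictly convex, i.e. $A_\Sigma^\eta$ is positive definite at every point of $\Sigma$. Let $\mathbf{B}\subset\mathbb{R}^2$ be the open unit disk, let $H>0$, and let $u:(\overline{\mathbf{B}},\partial\mathbf{B})\to(\overline\Omega,\Sigma)$ be smooth up to the boundary with $$\Delta u=H\,u_{x^1}\times u_{x^2},\qquad |u_{x^1}|=|u_{x^2}|,\quad \langle u_{x^1},u_{x^2}\rangle=0\quad\text{on }\overline{\mathbf{B}},\qquad u_r(x)\perp T_{u(x)}\Sigma\quad\text{for all }x\in\partial\mathbf{B}.$$ Let $\mathbf{n}=\frac{u_{x^1}\times u_{x^2}}{|u_{x^1}\times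 u_{x^2}|}$ be the unit normal of $u$ (away from the zeros of $\nabla u$). The smooth sections of the normal bundle of $u$ are written $f\mathbf{n}$ with $f\in C^\infty(\overline{\mathbf{B}})$, and $$B_H(u)(f\mathbf{n},f\mathbf{n})=\int_{\mathbf{B}}|\nabla f|^2-f^2\,\frac{|\nabla u|^2}{2}\cdot\frac{H^2}{2}\,dx^1dx^2+\int_{\partial\mathbf{B}}f^2A_\Sigma^{u_r}(\mathbf{n},\mathbf{n})\,d\theta,$$ where the boundary integrand is read as $0$ at points with $\nabla u=0$ (there $u_r=0$). The index of $B_H(u)$ is the largest dimension of a linear space of functions $f\in C^\infty(\overline{\mathbf{B}})$ on which this form is negative definite. If the index of $B_H(u)$ is at most $1$, then $$D(u):=\int_{\mathbf{B}}\frac{|\nabla u|^2}{2}\,dx^1dx^2\le\frac{16\pi}{H^2}.$$ -/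

import Mathlib

open scoped ContDiff Manifold

noncomputable section

namespace FreeBoundaryCMC

/-- Euclidean three-space. -/
abbrev E3 : Type := EuclideanSpace ℝ (Fin 3)

/-- Smooth diffeomorphisms of Euclidean three-space onto itself. -/
abbrev Diffeo3 : Type := Diffeomorph 𝓘(ℝ, E3) 𝓘(ℝ, E3) E3 E3 ∞

/-- The closed unit disk; the plane `ℝ²` is written as `ℂ`, with `x¹ + i x²` for `(x¹, x²)`. -/
def disk : Set ℂ := Metric.closedBall 0 1

/-- The cross product on Euclidean three-space. -/
def cross (a b : E3) : E3 := WithLp.toLp 2 (crossProduct (WithLp.ofLp a) (WithLp.ofLp b))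

/-! ### The constraint surface -/

/-- The surface `Σ`: the image of the round unit sphere under a diffeomorphism of `ℝ³`. -/
def surface (Φ : Diffeo3) : Set E3 := Φ '' Metric.sphere 0 1

/-- The bounded open region `Ω` enclosed by the surface. -/
def region (Φ : Diffeo3) : Set E3 := Φ '' Metric.ball 0 1

/-- The tangent plane of the surface at `y`: the image under `dΦ` of the tangent plane of the
unit sphere at `Φ⁻¹ y`. -/
def tangentPlane (Φ : Diffeo3) (y : E3) : Submodule ℝ E3 :=
  ((ℝ ∙ (Φ.symm y))ᗮ).map (fderiv ℝ Φ (Φ.symm y)).toLinearMap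

/-- The function `|Φ⁻¹ y|²`, which is `< 1` in the region, `= 1` on the surface and `> 1`
outside, and whose gradient does not vanish on the surface. -/
def definingFunction (Φ : Diffeo3) (y : E3) : ℝ := ‖Φ.symm y‖ ^ 2

/-- The inward unit normal `η` of the surface. The formula also extends it smoothly to a
neighbourhood of the surface. -/
def inwardNormal (Φ : Diffeo3) (y : E3) : E3 :=
  -(‖gradient (definingFunction Φ) y‖⁻¹ • gradient (definingFunction Φ) y)

/-- `A^η(X, Y) = -⟨D_X η, Y⟩`: the second fundamental form of the surface at the point `y` with
respect to the inward unit normal, for tangent vectors `X, Y`. -/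
def secondFundamentalForm (Φ : Diffeo3) (y X Y : E3) : ℝ :=
  -inner ℝ (fderiv ℝ (inwardNormal Φ) y X) Y

/-- `A^w(X, Y) = ⟨w, η⟩ A^η(X, Y)`: the second fundamental form of the surface at `y` in the
direction of the normal vector `w`. -/
def secondFundamentalFormDir (Φ : Diffeo3) (y w X Y : E3) : ℝ :=
  inner ℝ w (inwardNormal Φ y) * secondFundamentalForm Φ y X Y

/-- Strict convexity: `A^η` is positive definite at every point of the surface. -/
def IsStrictlyConvex (Φ : Diffeo3) : Prop :=
  ∀ y ∈ surface Φ, ∀ X ∈ tangentPlane Φ y, X ≠ 0 → 0 < secondFundamentalForm Φ y X X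

/-! ### Maps on the closed disk -/

section Maps

variable {F : Type*} [NormedAddCommGroup F] [InnerProductSpace ℝ F]

/-- The derivative of a map on the closed disk in the direction `e`. -/
def dirDeriv (u : ℂ → F) (e x : ℂ) : F := fderivWithin ℝ u disk x e

/-- The partial derivative `u_{x¹}`. -/
def partial₁ (u : ℂ → F) (x : ℂ) : F := dirDeriv u 1 x

/-- The partial derivative `u_{x²}`. -/
def partial₂ (u : ℂ → F) (x : ℂ) : F := dirDeriv u Complex.I x

/-- The radial derivative `u_r` at points of the unit circle. -/
def radialDeriv (u : ℂ → F) (x : ℂ) : F := dirDeriv u x x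

/-- `|∇u|² = |u_{x¹}|² + |u_{x²}|²`. -/
def gradSq (u : ℂ → F) (x : ℂ) : ℝ := ‖partial₁ u x‖ ^ 2 + ‖partial₂ u x‖ ^ 2

/-- The Dirichlet energy `D(u) = ∫_B |∇u|² / 2`. -/
def dirichletEnergy (u : ℂ → F) : ℝ := ∫ x in Metric.ball (0 : ℂ) 1, gradSq u x / 2

end Maps

/-- `u : (B̄, ∂B) → (Ω̄, Σ)` is smooth up to the boundary and is a weakly conformal solution of
the constant mean curvature equation which meets the surface orthogonally along `∂B`. -/
structure IsFreeBoundaryCMCDisk (Φ : Diffeo3) (H : ℝ) (u : ℂ → E3) : Prop where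
  smooth : ContDiffOn ℝ ∞ u disk
  mapsTo_closure : ∀ x ∈ disk, u x ∈ closure (region Φ)
  mapsTo_surface : ∀ x ∈ Metric.sphere (0 : ℂ) 1, u x ∈ surface Φ
  cmc : ∀ x ∈ disk,
    InnerProductSpace.laplacianWithin u disk x = H • cross (partial₁ u x) (partial₂ u x)
  conformal_norm : ∀ x ∈ disk, ‖partial₁ u x‖ = ‖partial₂ u x‖
  conformal_inner : ∀ x ∈ disk, inner ℝ (partial₁ u x) (partial₂ u x) = 0
  orthogonal : ∀ x ∈ Metric.sphere (0 : ℂ) 1, ∀ X ∈ tangentPlane Φ (u x),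
    inner ℝ (radialDeriv u x) X = 0

/-! ### The bilinear form and its index -/

/-- The unit normal `n = u_{x¹} × u_{x²} / |u_{x¹} × u_{x²}|` of the map `u`. At a branch point
(a zero of `∇u`) the formula returns `0`; below, `n` only enters through the boundary term
`A^{u_r}(n, n)`, which vanishes at a branch point for every value of `n` because `u_r = 0`. -/
def unitNormal (u : ℂ → E3) (x : ℂ) : E3 :=
  ‖cross (partial₁ u x) (partial₂ u x)‖⁻¹ • cross (partial₁ u x) (partial₂ u x)

/-- The value `B_H(u)(s, s)` at the section `s = f n` of the normal bundle of `u`: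
`∫_B |∇f|² - f² (|∇u|² / 2) (H² / 2) + ∫_{∂B} f² A^{u_r}(n, n) dθ`. The normal bundle is a trivial
line bundle spanned by the unit normal, so that its smooth sections are exactly the products
`f n` with `f` smooth on the closed disk. -/
def formB (Φ : Diffeo3) (H : ℝ) (u : ℂ → E3) (f : ℂ → ℝ) : ℝ :=
  (∫ x in Metric.ball (0 : ℂ) 1, (gradSq f x - f x ^ 2 * (gradSq u x / 2) * (H ^ 2 / 2))) +
    ∫ θ in (0 : ℝ)..(2 * Real.pi),
      f (circleMap 0 1 θ) ^ 2 *
        secondFundamentalFormDir Φ (u (circleMap 0 1 θ)) (radialDeriv u (circleMap 0 1 θ))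
          (unitNormal u (circleMap 0 1 θ)) (unitNormal u (circleMap 0 1 θ))

/-- `W` is a space of functions, smooth up to the boundary of the disk, on which the form is
negative definite. (Functions on `ℂ` stand for their restrictions to the closed disk; nothing is
counted twice, since a function vanishing on the disk has form value zero.) -/
def IsNegativeSpace (Φ : Diffeo3) (H : ℝ) (u : ℂ → E3) (W : Submodule ℝ (ℂ → ℝ)) : Prop :=
  (∀ f ∈ W, ContDiffOn ℝ ∞ f disk) ∧ ∀ f ∈ W, f ≠ 0 → formB Φ H u f < 0

/-- The index of `B_H(u)`: the largest dimension of a space of smooth sections on which the form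
is negative definite. -/
def indexB (Φ : Diffeo3) (H : ℝ) (u : ℂ → E3) : ℕ∞ :=
  ⨆ (W : Submodule ℝ (ℂ → ℝ)) (_ : IsNegativeSpace Φ H u W), Cardinal.toENat (Module.rank ℝ W)

/-- The boundary coefficient of `B_H(u)` is the same for every choice of a unit normal field
along `u`, at branch points included. -/
theorem secondFundamentalFormDir_unitNormal {Φ : Diffeo3} {H : ℝ} {u : ℂ → E3}
    (hu : IsFreeBoundaryCMCDisk Φ H u) {x : ℂ} (hx : x ∈ disk) {n : E3} (hn : ‖n‖ = 1)
    (h₁ : inner ℝ n (partial₁ u x) = 0) (h₂ : inner ℝ n (partial₂ u x) = 0) :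
    secondFundamentalFormDir Φ (u x) (radialDeriv u x) n n =
      secondFundamentalFormDir Φ (u x) (radialDeriv u x) (unitNormal u x) (unitNormal u x) := by
  have hc := hu.conformal_norm x hx
  have hi := hu.conformal_inner x hx
  have hr : radialDeriv u x = x.re • partial₁ u x + x.im • partial₂ u x := by
    have hd : x = x.re • (1 : ℂ) + x.im • Complex.I := by
      apply Complex.ext <;> simp
    unfold radialDeriv partial₁ partial₂ dirDeriv
    rw [← map_smul, ← map_smul, ← map_add, ← hd]
  by_cases h0 : partial₁ u x = 0
  · have h0' : partial₂ u x = 0 := by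
      rw [h0, norm_zero] at hc
      exact norm_eq_zero.1 hc.symm
    simp [secondFundamentalFormDir, hr, h0, h0']
  · obtain ⟨c, hcn, hc2⟩ : ∃ c : ℝ, unitNormal u x = c • n ∧ c ^ 2 = 1 := by
      have hw : cross (partial₁ u x) (partial₂ u x) ≠ 0 ∧
          (inner ℝ (cross (partial₁ u x) (partial₂ u x)) n) ^ 2 =
            ‖cross (partial₁ u x) (partial₂ u x)‖ ^ 2 := by
        have ha : 0 < ‖partial₁ u x‖ ^ 2 := by positivity
        have hb : 0 < ‖partial₂ u x‖ ^ 2 := by rw [← hc]; exact ha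
        have hn' : ‖n‖ ^ 2 = 1 := by rw [hn]; norm_num
        generalize partial₁ u x = a at *
        generalize partial₂ u x = b at *
        have hL : ‖cross a b‖ ^ 2 = ‖a‖ ^ 2 * ‖b‖ ^ 2 := by
          simp only [cross, crossProduct, EuclideanSpace.real_norm_sq_eq, Fin.sum_univ_three,
            PiLp.inner_apply, RCLike.inner_apply, conj_trivial, LinearMap.mk₂_apply,
            Matrix.cons_val] at *
          linear_combination (-(b 0 * a 0 + b 1 * a 1 + b 2 * a 2)) * hi
        have hG : (inner ℝ (cross a b) n) ^ 2 = ‖a‖ ^ 2 * ‖b‖ ^ 2 := by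
          have hG' : (inner ℝ (cross a b) n) ^ 2 = ‖a‖ ^ 2 * ‖b‖ ^ 2 * ‖n‖ ^ 2
              + 2 * inner ℝ a b * inner ℝ n a * inner ℝ n b - ‖a‖ ^ 2 * inner ℝ n b ^ 2
              - ‖b‖ ^ 2 * inner ℝ n a ^ 2 - ‖n‖ ^ 2 * inner ℝ a b ^ 2 := by
            simp only [cross, crossProduct, EuclideanSpace.real_norm_sq_eq, Fin.sum_univ_three,
              PiLp.inner_apply, RCLike.inner_apply, conj_trivial, LinearMap.mk₂_apply,
              Matrix.cons_val]
            ring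
          rw [hG', hi, h₁, h₂, hn']; ring
        refine ⟨fun h => ?_, hG.trans hL.symm⟩
        rw [h, norm_zero] at hL
        nlinarith [mul_pos ha hb]
      obtain ⟨hw0, hw⟩ := hw
      set w := cross (partial₁ u x) (partial₂ u x) with hwdef
      have hpos : ‖w‖ ≠ 0 := norm_ne_zero_iff.2 hw0
      have hwn : w = (inner ℝ w n : ℝ) • n := by
        rw [← sub_eq_zero, ← norm_eq_zero, ← sq_eq_zero_iff, norm_sub_sq_real, norm_smul, hn,
          inner_smul_right, Real.norm_eq_abs, mul_one, sq_abs]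
        linear_combination -hw
      refine ⟨‖w‖⁻¹ * inner ℝ w n, ?_, ?_⟩
      · rw [mul_smul, ← hwn, hwdef]; rfl
      · rw [mul_pow, hw]; field_simp
    simp only [secondFundamentalFormDir, secondFundamentalForm, hcn, map_smul, inner_smul_left,
      inner_smul_right]
    simp only [conj_trivial]
    linear_combination (inner ℝ (radialDeriv u x) (inwardNormal Φ (u x)) *
      inner ℝ ((fderiv ℝ (inwardNormal Φ) (u x)) n) n) * hc2

end FreeBoundaryCMC

end

/-!
On functions `f` that are smooth on the closed disk the form is `∫_B |∇f|² - ∫ f² dν`, where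
`ν = (H²/2) (|∇u|²/2) dx - A^{u_r}(n, n) dθ` is a finite measure on the closed disk without atoms
(`indexMeasure`, `formB_eq`). It is positive: since `u` stays in the closed region, `u_r` points
outwards along the circle, and orthogonality makes the unit normal `n` of `u` tangent to the
surface there, so that strict convexity gives `A^{u_r}(n, n) ≤ 0` (`boundaryCoefficient_nonpos`).
Hence `(H²/2) D(u) ≤ ν(B̄)`, and it remains to show `ν(B̄) ≤ 8π`.

If `ν ≠ 0`, the constants span a line on which the form is negative. As they are orthogonal for the
form to every `f` with `∫ f dν = 0`, index at most one forces the form to be nonnegative on such `f`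
(`formB_nonneg_of_integral_eq_zero`). Following Hersch, one tests with the three components of a
conformal map `φ : B̄ → S²` with `∫ φ dν = 0`. Their squares sum to one, and the sum of
their Dirichlet integrals is twice the area covered by `φ`, hence at most `8π`; so
`0 ≤ 8π - ν(B̄)`.

The balanced map `φ` is an affine map `z ↦ (z - c) / s` followed by the inverse stereographic
projection. The pair `(c, s)` is found without a fixed point theorem, as a minimum over the upper
half-space of `∫ log ((|z - c|² + s²) / s) dν(z)`, the average of the Busemann functions of
hyperbolic space, which is proper because `ν` has no atoms (`exists_min_busemannAverage`). The
vanishing of its first variation says exactly that `∫ φ dν = 0` (`exists_conformal_barycenter`).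
-/

namespace FreeBoundaryCMC

open MeasureTheory Set Filter Topology Metric

/-! ### Conformal barycentre of a measure on the disk -/

theorem integrable_of_continuous_of_disk {ν : Measure ℂ} [IsFiniteMeasure ν]
    (hν : ∀ᵐ z ∂ν, z ∈ disk) {f : ℂ → ℝ} (hf : Continuous f) : Integrable f ν := by
  rw [← Measure.restrict_eq_self_of_ae_mem hν]
  exact hf.continuousOn.integrableOn_compact (isCompact_closedBall 0 1)

/-- A finite measure on the disk without atoms is small on all balls of some uniform radius. -/
theorem exists_measure_ball_le {ν : Measure ℂ} [IsFiniteMeasure ν] [NullSingletonClass ν]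
    (hν : ∀ᵐ z ∂ν, z ∈ disk) {ε : ℝ} (hε : 0 < ε) :
    ∃ δ > 0, ∀ c : ℂ, ν.real (ball c δ) ≤ ε := by
  have hU : ∀ z : ℂ, ∃ U, U ⊇ {z} ∧ IsOpen U ∧ ν U < ENNReal.ofReal ε := fun z =>
    Set.exists_isOpen_lt_of_lt {z} _ (by simpa using hε)
  choose U hzU hUo hUε using hU
  obtain ⟨δ, hδ, h⟩ := lebesgue_number_lemma_of_metric (isCompact_closedBall (0 : ℂ) 1) hUo
    (fun z _ => mem_iUnion.2 ⟨z, hzU z rfl⟩)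
  refine ⟨δ / 2, by positivity, fun c => ?_⟩
  by_cases hc : ∃ x ∈ ball c (δ / 2), x ∈ disk
  · obtain ⟨x, hx, hxd⟩ := hc
    obtain ⟨i, hi⟩ := h x hxd
    have hsub : ball c (δ / 2) ⊆ U i := by
      refine Subset.trans (ball_subset_ball' ?_) hi
      rw [mem_ball, dist_comm] at hx
      linarith
    exact ENNReal.toReal_le_of_le_ofReal hε.le ((measure_mono hsub).trans (hUε i).le)
  · push Not at hc
    have : ν (ball c (δ / 2)) = 0 :=
      measure_mono_null (fun x hx => hc x hx) (mem_ae_iff.1 hν)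
    simp [Measure.real, this, hε.le]

/-- `|z - c|² + s²`, the denominator of the inverse stereographic projection of `(z - c) / s`. -/
noncomputable def stereoDenom (c : ℂ) (s : ℝ) (z : ℂ) : ℝ :=
  (z.re - c.re) ^ 2 + (z.im - c.im) ^ 2 + s ^ 2

theorem stereoDenom_eq (c : ℂ) (s : ℝ) (z : ℂ) : stereoDenom c s z = ‖z - c‖ ^ 2 + s ^ 2 := by
  rw [← Complex.normSq_eq_norm_sq, Complex.normSq_apply, stereoDenom]
  simp only [Complex.sub_re, Complex.sub_im]
  ring

theorem stereoDenom_pos {s : ℝ} (hs : 0 < s) (c z : ℂ) : 0 < stereoDenom c s z := by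
  unfold stereoDenom; positivity

theorem continuous_stereoDenom (c : ℂ) (s : ℝ) : Continuous (stereoDenom c s) := by
  unfold stereoDenom; fun_prop

/-- The components of the inverse stereographic projection `ℂ → S²` after the affine map
`z ↦ (z - c) / s`; a conformal map into the unit sphere. -/
noncomputable def stereo (c : ℂ) (s : ℝ) : Fin 3 → ℂ → ℝ :=
  ![fun z => 2 * s * (z.re - c.re) / stereoDenom c s z,
    fun z => 2 * s * (z.im - c.im) / stereoDenom c s z,
    fun z => 1 - 2 * s ^ 2 / stereoDenom c s z]

theorem stereo_zero (c : ℂ) (s : ℝ) (z : ℂ) :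
    stereo c s 0 z = 2 * s * (z.re - c.re) / stereoDenom c s z := rfl

theorem stereo_one (c : ℂ) (s : ℝ) (z : ℂ) :
    stereo c s 1 z = 2 * s * (z.im - c.im) / stereoDenom c s z := rfl

theorem stereo_two (c : ℂ) (s : ℝ) (z : ℂ) :
    stereo c s 2 z = 1 - 2 * s ^ 2 / stereoDenom c s z := rfl

theorem sum_stereo_sq {s : ℝ} (hs : 0 < s) (c z : ℂ) : ∑ i, stereo c s i z ^ 2 = 1 := by
  have hN := (stereoDenom_pos hs c z).ne'
  rw [Fin.sum_univ_three, stereo_zero, stereo_one, stereo_two]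
  field_simp
  simp only [stereoDenom]
  ring

theorem contDiff_stereo {s : ℝ} (hs : 0 < s) (c : ℂ) (i : Fin 3) :
    ContDiff ℝ ∞ (stereo c s i) := by
  have hre : ContDiff ℝ ∞ fun z : ℂ => z.re - c.re := Complex.reCLM.contDiff.sub contDiff_const
  have him : ContDiff ℝ ∞ fun z : ℂ => z.im - c.im := Complex.imCLM.contDiff.sub contDiff_const
  have hN : ContDiff ℝ ∞ (stereoDenom c s) := ((hre.pow 2).add (him.pow 2)).add contDiff_const
  have hN0 : ∀ z, stereoDenom c s z ≠ 0 := fun z => (stereoDenom_pos hs c z).ne'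
  fin_cases i
  · exact (contDiff_const.mul hre).div hN hN0
  · exact (contDiff_const.mul him).div hN hN0
  · exact contDiff_const.sub (contDiff_const.div hN hN0)

/-- The average over `ν` of the Busemann functions of hyperbolic three-space based at the boundary
points `z ∈ ℂ`, evaluated at the point `(c, exp t)` of the upper half-space. -/
noncomputable def busemannAverage (ν : Measure ℂ) (p : ℂ × ℝ) : ℝ :=
  ∫ z, (Real.log (stereoDenom p.1 (Real.exp p.2) z) - p.2) ∂ν

theorem continuous_busemannAverage {ν : Measure ℂ} [IsFiniteMeasure ν]
    (hν : ∀ᵐ z ∂ν, z ∈ disk) : Continuous (busemannAverage ν) := by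
  have h := continuous_parametric_integral_of_continuous (μ := ν)
    (f := fun (p : ℂ × ℝ) (z : ℂ) => Real.log (stereoDenom p.1 (Real.exp p.2) z) - p.2)
    (s := disk) (by
      refine Continuous.sub (Continuous.log ?_ fun p => ?_) (by fun_prop)
      · unfold stereoDenom; fun_prop
      · exact (stereoDenom_pos (Real.exp_pos _) _ _).ne') (isCompact_closedBall 0 1)
  rwa [Measure.restrict_eq_self_of_ae_mem hν] at h

theorem integrable_busemann {ν : Measure ℂ} [IsFiniteMeasure ν]
    (hν : ∀ᵐ z ∂ν, z ∈ disk) (c : ℂ) (t : ℝ) :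
    Integrable (fun z => Real.log (stereoDenom c (Real.exp t) z) - t) ν :=
  integrable_of_continuous_of_disk hν (((continuous_stereoDenom _ _).log
    fun _ => (stereoDenom_pos (Real.exp_pos _) _ _).ne').sub continuous_const)

/-- The averaged Busemann function attains its minimum: it is proper because `ν` has no atoms. -/
theorem exists_min_busemannAverage {ν : Measure ℂ} [IsFiniteMeasure ν] [NullSingletonClass ν]
    (hν : ∀ᵐ z ∂ν, z ∈ disk) (hm : 0 < ν.real univ) :
    ∃ p, ∀ q, busemannAverage ν p ≤ busemannAverage ν q := by
  set m := ν.real univ with hmdef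
  obtain ⟨δ, hδ, hball⟩ := exists_measure_ball_le hν (show 0 < m / 4 by positivity)
  set C := busemannAverage ν 0 / m with hC
  have hCm : busemannAverage ν 0 = m * C := by rw [hC]; field_simp
  -- Outside `|c| ≤ R`, `t₀ ≤ t ≤ t₁` the average is at least its value `m * C` at the point `(0, 0)`:
  -- large `|c|` by the inequality of means, large `t` because the denominator is at least
  -- `exp (2 t)`, small `t` because most of the mass lies at distance at least `δ` from `c`.
  set t₀ := min (Real.log δ) (3 * Real.log δ - 2 * C)
  set t₁ := max C t₀
  set R := 1 + Real.exp C
  refine (continuous_busemannAverage hν).exists_forall_le' 0 ?_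
  refine mem_of_superset ((isCompact_closedBall (0 : ℂ) R).prod
    (isCompact_Icc (a := t₀) (b := t₁))).compl_mem_cocompact ?_
  rintro ⟨c, t⟩ hp
  -- A pointwise lower bound on the disk integrates to a lower bound for the average.
  have hconst : ∀ K : ℝ, C ≤ K →
      (∀ z ∈ disk, K ≤ Real.log (stereoDenom c (Real.exp t) z) - t) →
      busemannAverage ν 0 ≤ busemannAverage ν (c, t) := by
    intro K hCK hK
    rw [hCm]
    calc m * C ≤ m * K := by gcongr
      _ = ∫ _, K ∂ν := by simp [hmdef]
      _ ≤ _ := integral_mono_ae (integrable_const _) (integrable_busemann hν c t)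
        (hν.mono hK)
  have hexp : Real.exp t ^ 2 = Real.exp (t + t) := by rw [sq, Real.exp_add]
  by_cases hR : R < ‖c‖
  · refine hconst C le_rfl fun z hz => ?_
    have hz1 : ‖z‖ ≤ 1 := by simpa [disk] using hz
    have h1 : Real.exp C ≤ ‖z - c‖ := by
      have := norm_sub_norm_le c z
      rw [norm_sub_rev] at this
      linarith
    have h2 : Real.exp (C + t) ≤ stereoDenom c (Real.exp t) z := by
      rw [stereoDenom_eq, Real.exp_add]
      nlinarith [Real.exp_pos C, Real.exp_pos t, sq_nonneg (‖z - c‖ - Real.exp t)]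
    have := (Real.le_log_iff_exp_le (stereoDenom_pos (Real.exp_pos t) c z)).2 h2
    show C ≤ _
    linarith
  by_cases ht : t₁ < t
  · refine hconst t ((le_max_left _ _).trans ht.le) fun z _ => ?_
    have h2 : Real.exp (t + t) ≤ stereoDenom c (Real.exp t) z := by
      rw [stereoDenom_eq, hexp]; nlinarith [sq_nonneg ‖z - c‖]
    have := (Real.le_log_iff_exp_le (stereoDenom_pos (Real.exp_pos t) c z)).2 h2
    linarith
  have ht0 : t < t₀ := by
    by_contra h
    push Not at h hR ht
    exact hp ⟨by simpa using hR, h, ht⟩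
  have htδ : t ≤ Real.log δ := ht0.le.trans (min_le_left _ _)
  have htC : t ≤ 3 * Real.log δ - 2 * C := ht0.le.trans (min_le_right _ _)
  -- Off the small ball the integrand is at least `2 log δ - t`; on it, at least `t`.
  have hpt : ∀ z, (2 * Real.log δ - t) - (ball c δ).indicator (fun _ => 2 * (Real.log δ - t)) z
      ≤ Real.log (stereoDenom c (Real.exp t) z) - t := by
    intro z
    have hpos := stereoDenom_pos (Real.exp_pos t) c z
    by_cases hz : z ∈ ball c δ
    · rw [indicator_of_mem hz]
      have h2 : Real.exp (t + t) ≤ stereoDenom c (Real.exp t) z := by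
        rw [stereoDenom_eq, hexp]; nlinarith [sq_nonneg ‖z - c‖]
      have := (Real.le_log_iff_exp_le hpos).2 h2
      linarith
    · rw [indicator_of_notMem hz]
      have hz' : δ ≤ ‖z - c‖ := by simpa [dist_eq_norm] using hz
      have h2 : δ ^ 2 ≤ stereoDenom c (Real.exp t) z := by
        rw [stereoDenom_eq]; nlinarith [sq_nonneg (Real.exp t)]
      have := Real.log_le_log (by positivity) h2
      rw [Real.log_pow] at this
      push_cast at this
      linarith
  have hint : Integrable ((ball c δ).indicator fun _ : ℂ => 2 * (Real.log δ - t)) ν :=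
    (integrable_const _).indicator measurableSet_ball
  have hle := integral_mono ((integrable_const _).sub hint) (integrable_busemann hν c t) hpt
  simp only [Pi.sub_apply] at hle
  rw [integral_sub (integrable_const _) hint, integral_indicator_const _ measurableSet_ball,
    integral_const, ← hmdef, smul_eq_mul, smul_eq_mul] at hle
  have hb := mul_le_mul_of_nonneg_right (hball c) (show 0 ≤ 2 * (Real.log δ - t) by linarith)
  change busemannAverage ν 0 ≤ busemannAverage ν (c, t)
  change _ ≤ busemannAverage ν (c, t) at hle
  rw [hCm]
  have h3 := mul_le_mul_of_nonneg_left htC hm.le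
  nlinarith

/-- If `a ε + b ε² ≥ 0` for all small `ε`, then `a = 0`. -/
theorem eq_zero_of_forall_quadratic_nonneg {a b : ℝ}
    (h : ∀ ε : ℝ, |ε| < 1 → 0 ≤ ε * a + ε ^ 2 * b) : a = 0 := by
  by_contra ha
  set k := 2 * (|a| + |b|)
  have ha' : 0 < |a| := abs_pos.2 ha
  have hk : 0 < k := by positivity
  have h1 := h (-(a / k)) (by
    rw [abs_neg, abs_div, abs_of_pos hk, div_lt_one hk]
    have := abs_nonneg b
    simp only [k]; linarith)
  have h2 : -(a / k) * a + (-(a / k)) ^ 2 * b = a ^ 2 / k ^ 2 * (b - k) := by field_simp; ring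
  rw [h2] at h1
  have h3 : b - k < 0 := by
    have := le_abs_self b
    have := abs_nonneg b
    simp only [k]; linarith
  have h4 : 0 < a ^ 2 / k ^ 2 := by positivity
  nlinarith

theorem integrable_div_stereoDenom {ν : Measure ℂ} [IsFiniteMeasure ν]
    (hν : ∀ᵐ z ∂ν, z ∈ disk) {s : ℝ} (hs : 0 < s) (c : ℂ) {g : ℂ → ℝ} (hg : Continuous g) :
    Integrable (fun z => g z / stereoDenom c s z) ν :=
  integrable_of_continuous_of_disk hν
    (hg.div (continuous_stereoDenom _ _) fun z => (stereoDenom_pos hs c z).ne')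

/-- The conformal barycentre: for a measure `ν` without atoms, some affine map `z ↦ (z - c) / s`
followed by the inverse stereographic projection carries `ν` to a measure on the sphere whose
centre of mass is the origin. -/
theorem exists_conformal_barycenter {ν : Measure ℂ} [IsFiniteMeasure ν] [NullSingletonClass ν]
    (hν : ∀ᵐ z ∂ν, z ∈ disk) (hm : 0 < ν.real univ) :
    ∃ c : ℂ, ∃ s > 0, ∀ i, ∫ z, stereo c s i z ∂ν = 0 := by
  obtain ⟨⟨c, t⟩, hmin⟩ := exists_min_busemannAverage hν hm
  set s := Real.exp t with hst
  have hs : 0 < s := Real.exp_pos t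
  -- By `log x ≤ x - 1`, minimality bounds an average of ratios, without differentiating.
  have key : ∀ (c' : ℂ) (s' : ℝ), 0 < s' →
      0 ≤ ∫ z, (stereoDenom c' s' z / stereoDenom c s z * (s / s') - 1) ∂ν := by
    intro c' s' hs'
    have h := hmin (c', Real.log s')
    rw [← sub_nonneg, busemannAverage, busemannAverage,
      ← integral_sub (integrable_busemann hν _ _) (integrable_busemann hν _ _)] at h
    refine h.trans (integral_mono
      ((integrable_busemann hν _ _).sub (integrable_busemann hν _ _)) ?_ fun z => ?_)
    · refine Integrable.sub ((integrable_div_stereoDenom hν hs c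
        (continuous_stereoDenom _ _)).mul_const _) (integrable_const _)
    · have hN := stereoDenom_pos hs c z
      have hN' := stereoDenom_pos hs' c' z
      have hl := Real.log_le_sub_one_of_pos
        (show 0 < stereoDenom c' s' z / stereoDenom c s z * (s / s') by positivity)
      rw [Real.log_mul (by positivity) (by positivity), Real.log_div hN'.ne' hN.ne',
        Real.log_div hs.ne' hs'.ne', hst, Real.log_exp, ← hst] at hl
      simp only [Real.exp_log hs', ← hst]
      linarith
  have hq := integrable_div_stereoDenom hν hs c (continuous_const (y := (1 : ℝ)))
  have hi2 : Integrable (fun z => 1 - 2 * s ^ 2 / stereoDenom c s z) ν :=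
    (integrable_const _).sub (integrable_div_stereoDenom hν hs c continuous_const)
  have hre := integrable_div_stereoDenom hν hs c
    (show Continuous fun z : ℂ => 2 * s * (z.re - c.re) by fun_prop)
  have him := integrable_div_stereoDenom hν hs c
    (show Continuous fun z : ℂ => 2 * s * (z.im - c.im) by fun_prop)
  refine ⟨c, s, hs, fun i => ?_⟩
  fin_cases i
  · change ∫ z, 2 * s * (z.re - c.re) / stereoDenom c s z ∂ν = 0
    refine eq_zero_of_forall_quadratic_nonneg
      (b := ∫ z, s ^ 2 * (1 / stereoDenom c s z) ∂ν) fun ε _ => ?_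
    have h := key (c - (ε * s : ℝ)) s hs
    rw [← integral_const_mul, ← integral_const_mul, ← integral_add (hre.const_mul _)
      ((hq.const_mul _).const_mul _)]
    refine h.trans_eq (integral_congr_ae (ae_of_all _ fun z => ?_))
    have hN := (stereoDenom_pos hs c z).ne'
    simp only
    field_simp
    simp only [stereoDenom, Complex.sub_re, Complex.sub_im, Complex.ofReal_re, Complex.ofReal_im]
    ring
  · change ∫ z, 2 * s * (z.im - c.im) / stereoDenom c s z ∂ν = 0
    refine eq_zero_of_forall_quadratic_nonneg
      (b := ∫ z, s ^ 2 * (1 / stereoDenom c s z) ∂ν) fun ε _ => ?_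
    have h := key (c - (ε * s : ℝ) * Complex.I) s hs
    rw [← integral_const_mul, ← integral_const_mul, ← integral_add (him.const_mul _)
      ((hq.const_mul _).const_mul _)]
    refine h.trans_eq (integral_congr_ae (ae_of_all _ fun z => ?_))
    have hN := (stereoDenom_pos hs c z).ne'
    simp only
    field_simp
    simp only [stereoDenom, Complex.sub_re, Complex.sub_im, Complex.re_ofReal_mul,
      Complex.im_ofReal_mul, Complex.I_re, Complex.I_im]
    ring
  · change ∫ z, (1 - 2 * s ^ 2 / stereoDenom c s z) ∂ν = 0
    refine eq_zero_of_forall_quadratic_nonneg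
      (b := ∫ z, s ^ 2 * (1 / stereoDenom c s z) ∂ν) fun ε hε => ?_
    rw [abs_lt] at hε
    have h1 : 0 < 1 - ε := by linarith
    have h := key c (s * (1 - ε)) (by positivity)
    rw [← integral_const_mul, ← integral_const_mul, ← integral_add (hi2.const_mul _)
      ((hq.const_mul _).const_mul _)]
    have h' := mul_nonneg h1.le h
    rw [← integral_const_mul] at h'
    refine h'.trans_eq (integral_congr_ae (ae_of_all _ fun z => ?_))
    have hN := (stereoDenom_pos hs c z).ne'
    have h1' := h1.ne'
    simp only
    field_simp
    simp only [stereoDenom]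
    ring

/-! ### Dirichlet energy of the stereographic maps -/

theorem uniqueDiffOn_disk : UniqueDiffOn ℝ disk :=
  uniqueDiffOn_convex (convex_closedBall 0 1) (by
    rw [disk, interior_closedBall _ one_ne_zero]; exact ⟨0, by simp⟩)

theorem gradSq_eq {f : ℂ → ℝ} {x : ℂ} (hx : x ∈ disk) {f' : ℂ →L[ℝ] ℝ}
    (hf : HasFDerivAt f f' x) : gradSq f x = f' 1 ^ 2 + f' Complex.I ^ 2 := by
  simp only [gradSq, partial₁, partial₂, dirDeriv,
    hf.hasFDerivWithinAt.fderivWithin (uniqueDiffOn_disk x hx), Real.norm_eq_abs, sq_abs]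

theorem sum_gradSq_stereo {s : ℝ} (hs : 0 < s) (c : ℂ) {x : ℂ} (hx : x ∈ disk) :
    ∑ i, gradSq (stereo c s i) x = 8 * s ^ 2 / stereoDenom c s x ^ 2 := by
  have hre : HasFDerivAt (fun z : ℂ => z.re - c.re) Complex.reCLM x :=
    Complex.reCLM.hasFDerivAt.sub_const _
  have him : HasFDerivAt (fun z : ℂ => z.im - c.im) Complex.imCLM x :=
    Complex.imCLM.hasFDerivAt.sub_const _
  have hN : HasFDerivAt (stereoDenom c s) _ x := ((hre.pow 2).add (him.pow 2)).add_const (s ^ 2)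
  have hN0 : stereoDenom c s x ≠ 0 := (stereoDenom_pos hs c x).ne'
  have hI : HasFDerivAt (fun z => (stereoDenom c s z)⁻¹) _ x :=
    (hasDerivAt_inv hN0).comp_hasFDerivAt x hN
  have h0 : HasFDerivAt (stereo c s 0) _ x := (hre.const_mul (2 * s)).mul hI
  have h1 : HasFDerivAt (stereo c s 1) _ x := (him.const_mul (2 * s)).mul hI
  have h2 : HasFDerivAt (stereo c s 2) _ x := (hI.const_mul (2 * s ^ 2)).const_sub 1
  rw [Fin.sum_univ_three, gradSq_eq hx h0, gradSq_eq hx h1, gradSq_eq hx h2]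
  simp
  field_simp
  simp only [stereoDenom]
  ring

theorem integral_stereo_energy {s : ℝ} (hs : 0 < s) (c : ℂ) :
    Integrable (fun z => 8 * s ^ 2 / stereoDenom c s z ^ 2) ∧
      ∫ z, 8 * s ^ 2 / stereoDenom c s z ^ 2 = 8 * Real.pi := by
  -- In polar coordinates the integrand `r · 8 s² / (r² + s²)²` has a rational primitive.
  have hd : ∀ r ∈ Ici (0 : ℝ), HasDerivAt (fun r => -(4 * s ^ 2) * (r ^ 2 + s ^ 2)⁻¹)
      (r ^ (Module.finrank ℝ ℂ - 1) • (8 * s ^ 2 / (r ^ 2 + s ^ 2) ^ 2)) r := by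
    intro r _
    have h0 : r ^ 2 + s ^ 2 ≠ 0 := by positivity
    have h := ((((hasDerivAt_id r).pow 2).add_const (s ^ 2)).inv h0).const_mul (-(4 * s ^ 2))
    refine h.congr_deriv ?_
    simp only [Complex.finrank_real_complex, smul_eq_mul, id, Pi.pow_apply]
    field_simp
    norm_num
    ring
  have hpos : ∀ r ∈ Ioi (0 : ℝ),
      0 ≤ r ^ (Module.finrank ℝ ℂ - 1) • (8 * s ^ 2 / (r ^ 2 + s ^ 2) ^ 2) := by
    intro r hr
    have : (0 : ℝ) < r := hr
    positivity
  have hlim : Tendsto (fun r : ℝ => -(4 * s ^ 2) * (r ^ 2 + s ^ 2)⁻¹) atTop (𝓝 0) := by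
    rw [← mul_zero (-(4 * s ^ 2))]
    refine Tendsto.const_mul _ (tendsto_inv_atTop_zero.comp ?_)
    exact tendsto_atTop_add_const_right _ _ (tendsto_pow_atTop two_ne_zero)
  have hI := (integrable_fun_norm_addHaar (volume : Measure ℂ)
    (f := fun r => 8 * s ^ 2 / (r ^ 2 + s ^ 2) ^ 2)).2
    (integrableOn_Ioi_deriv_of_nonneg' hd hpos hlim)
  have hv := integral_fun_norm_addHaar (volume : Measure ℂ)
    (fun r => 8 * s ^ 2 / (r ^ 2 + s ^ 2) ^ 2)
  rw [integral_Ioi_of_hasDerivAt_of_nonneg' hd hpos hlim] at hv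
  simp only [stereoDenom_eq]
  refine ⟨hI.comp_sub_right c, ?_⟩
  rw [integral_sub_right_eq_self (fun z : ℂ => 8 * s ^ 2 / (‖z‖ ^ 2 + s ^ 2) ^ 2) c, hv]
  simp [Measure.real, Complex.volume_ball]
  field_simp
  norm_num

/-- The stereographic maps cover at most the sphere, so that by conformality their energy is at
most twice the area `4π`. -/
theorem integral_sum_gradSq_stereo_le {s : ℝ} (hs : 0 < s) (c : ℂ) :
    ∫ x in ball (0 : ℂ) 1, ∑ i, gradSq (stereo c s i) x ≤ 8 * Real.pi := by
  obtain ⟨hi, hv⟩ := integral_stereo_energy hs c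
  rw [← hv, setIntegral_congr_fun measurableSet_ball fun x hx =>
    sum_gradSq_stereo hs c (ball_subset_closedBall hx)]
  exact setIntegral_le_integral hi (ae_of_all _ fun z => by positivity)

/-! ### Geometry of the constraint surface -/

theorem contDiff_definingFunction (Φ : Diffeo3) : ContDiff ℝ ∞ (definingFunction Φ) :=
  Φ.symm.contDiff.norm_sq ℝ

theorem fderiv_definingFunction (Φ : Diffeo3) (y v : E3) :
    fderiv ℝ (definingFunction Φ) y v =
      2 * inner ℝ (Φ.symm y) (fderiv ℝ Φ.symm y v) := by
  have h : HasFDerivAt Φ.symm (fderiv ℝ Φ.symm y) y :=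
    (Φ.symm.contDiff.differentiable (by simp) y).hasFDerivAt
  have h' : HasFDerivAt (definingFunction Φ) _ y := h.norm_sq
  rw [h'.fderiv]
  simp

theorem inner_gradient_definingFunction (Φ : Diffeo3) (y v : E3) :
    inner ℝ (gradient (definingFunction Φ) y) v = fderiv ℝ (definingFunction Φ) y v := by
  rw [← toDual_gradient, InnerProductSpace.toDual_apply_apply]

theorem fderiv_symm_apply_fderiv (Φ : Diffeo3) (y v : E3) :
    fderiv ℝ Φ.symm y (fderiv ℝ Φ (Φ.symm y) v) = v := by
  have h₁ : HasFDerivAt Φ (fderiv ℝ Φ (Φ.symm y)) (Φ.symm y) :=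
    (Φ.contDiff.differentiable (by simp) _).hasFDerivAt
  have h₂ : HasFDerivAt Φ.symm (fderiv ℝ Φ.symm y) (Φ (Φ.symm y)) := by
    rw [Φ.apply_symm_apply]
    exact (Φ.symm.contDiff.differentiable (by simp) y).hasFDerivAt
  have h := (h₂.comp _ h₁).unique ((hasFDerivAt_id (Φ.symm y)).congr_of_eventuallyEq
    (Eventually.of_forall fun p => Φ.symm_apply_apply p))
  exact DFunLike.congr_fun h v

theorem fderiv_apply_fderiv_symm (Φ : Diffeo3) (y v : E3) :
    fderiv ℝ Φ (Φ.symm y) (fderiv ℝ Φ.symm y v) = v := by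
  have h₁ : HasFDerivAt Φ (fderiv ℝ Φ (Φ.symm y)) (Φ.symm y) :=
    (Φ.contDiff.differentiable (by simp) _).hasFDerivAt
  have h₂ : HasFDerivAt Φ.symm (fderiv ℝ Φ.symm y) y :=
    (Φ.symm.contDiff.differentiable (by simp) y).hasFDerivAt
  have h := (h₁.comp y h₂).unique ((hasFDerivAt_id y).congr_of_eventuallyEq
    (Eventually.of_forall fun p => Φ.apply_symm_apply p))
  exact DFunLike.congr_fun h v

theorem norm_symm_of_mem_surface {Φ : Diffeo3} {y : E3} (hy : y ∈ surface Φ) :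
    ‖Φ.symm y‖ = 1 := by
  obtain ⟨p, hp, rfl⟩ := hy
  rw [Φ.symm_apply_apply]
  simpa using hp

theorem gradient_definingFunction_ne_zero {Φ : Diffeo3} {y : E3} (hy : y ∈ surface Φ) :
    gradient (definingFunction Φ) y ≠ 0 := by
  intro h
  have h1 := inner_gradient_definingFunction Φ y (fderiv ℝ Φ (Φ.symm y) (Φ.symm y))
  rw [h, inner_zero_left, fderiv_definingFunction, fderiv_symm_apply_fderiv,
    real_inner_self_eq_norm_sq, norm_symm_of_mem_surface hy] at h1
  norm_num at h1

theorem mem_tangentPlane_of_inner_gradient_eq_zero {Φ : Diffeo3} {y v : E3}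
    (hv : inner ℝ (gradient (definingFunction Φ) y) v = 0) : v ∈ tangentPlane Φ y := by
  rw [inner_gradient_definingFunction, fderiv_definingFunction] at hv
  refine ⟨fderiv ℝ Φ.symm y v, ?_, fderiv_apply_fderiv_symm Φ y v⟩
  rw [SetLike.mem_coe, Submodule.mem_orthogonal_singleton_iff_inner_right]
  linarith

theorem definingFunction_le_one {Φ : Diffeo3} {y : E3} (hy : y ∈ closure (region Φ)) :
    definingFunction Φ y ≤ 1 := by
  refine closure_minimal (t := {y | definingFunction Φ y ≤ 1}) ?_
    (isClosed_le (contDiff_definingFunction Φ).continuous continuous_const) hy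
  rintro _ ⟨p, hp, rfl⟩
  have hp' : ‖p‖ < 1 := by simpa using hp
  change ‖Φ.symm (Φ p)‖ ^ 2 ≤ 1
  rw [Φ.symm_apply_apply]
  nlinarith [norm_nonneg p]

theorem contDiffAt_inwardNormal {Φ : Diffeo3} {y : E3} (hy : y ∈ surface Φ) :
    ContDiffAt ℝ 1 (inwardNormal Φ) y := by
  have hg : ContDiff ℝ 1 (gradient (definingFunction Φ)) :=
    (InnerProductSpace.toDual ℝ E3).symm.contDiff.comp
      ((contDiff_definingFunction Φ).fderiv_right (m := 1) (by norm_cast))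
  have h0 := gradient_definingFunction_ne_zero hy
  exact (((hg.contDiffAt.norm ℝ h0).inv (norm_ne_zero_iff.2 h0)).smul hg.contDiffAt).neg

/-! ### The boundary coefficient of the form -/

theorem continuousOn_dirDeriv {F : Type*} [NormedAddCommGroup F] [InnerProductSpace ℝ F]
    {u : ℂ → F} (hu : ContDiffOn ℝ ∞ u disk) {e : ℂ → ℂ} (he : Continuous e) :
    ContinuousOn (fun x => dirDeriv u (e x) x) disk :=
  (hu.continuousOn_fderivWithin uniqueDiffOn_disk (by simp)).clm_apply he.continuousOn

theorem continuousOn_gradSq {F : Type*} [NormedAddCommGroup F] [InnerProductSpace ℝ F]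
    {u : ℂ → F} (hu : ContDiffOn ℝ ∞ u disk) : ContinuousOn (gradSq u) disk :=
  ((continuousOn_dirDeriv hu continuous_const).norm.pow 2).add
    ((continuousOn_dirDeriv hu continuous_const).norm.pow 2)

theorem continuous_cross : Continuous fun p : E3 × E3 => cross p.1 p.2 := by
  unfold cross
  refine (PiLp.continuous_toLp 2 _).comp (continuous_pi fun i => ?_)
  fin_cases i <;> simp [crossProduct] <;> fun_prop

theorem inner_cross_left (a b : E3) : inner ℝ a (cross a b) = 0 := by
  simp only [cross, crossProduct, Fin.sum_univ_three, PiLp.inner_apply, RCLike.inner_apply,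
    conj_trivial, LinearMap.mk₂_apply, Matrix.cons_val]
  ring

theorem inner_cross_right (a b : E3) : inner ℝ b (cross a b) = 0 := by
  simp only [cross, crossProduct, Fin.sum_univ_three, PiLp.inner_apply, RCLike.inner_apply,
    conj_trivial, LinearMap.mk₂_apply, Matrix.cons_val]
  ring

theorem radialDeriv_eq {F : Type*} [NormedAddCommGroup F] [InnerProductSpace ℝ F]
    (u : ℂ → F) (x : ℂ) : radialDeriv u x = x.re • partial₁ u x + x.im • partial₂ u x := by
  have hd : x = x.re • (1 : ℂ) + x.im • Complex.I := by
    apply Complex.ext <;> simp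
  unfold radialDeriv partial₁ partial₂ dirDeriv
  rw [← map_smul, ← map_smul, ← map_add, ← hd]

theorem inner_radialDeriv_unitNormal (u : ℂ → E3) (x : ℂ) :
    inner ℝ (radialDeriv u x) (unitNormal u x) = 0 := by
  rw [radialDeriv_eq, unitNormal, inner_smul_right, inner_add_left, real_inner_smul_left,
    real_inner_smul_left, inner_cross_left, inner_cross_right]
  simp

/-- Since `u` maps the disk into the closed region, its radial derivative at the boundary points
outwards. -/
theorem inner_gradient_radialDeriv_nonneg {Φ : Diffeo3} {H : ℝ} {u : ℂ → E3}
    (hu : IsFreeBoundaryCMCDisk Φ H u) {x : ℂ} (hx : x ∈ sphere (0 : ℂ) 1) :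
    0 ≤ inner ℝ (gradient (definingFunction Φ) (u x)) (radialDeriv u x) := by
  have hxd : x ∈ disk := sphere_subset_closedBall hx
  have hmax : IsLocalMaxOn (definingFunction Φ ∘ u) disk x := by
    refine IsMaxOn.localize fun z hz => ?_
    have h1 : definingFunction Φ (u x) = 1 := by
      rw [definingFunction, norm_symm_of_mem_surface (hu.mapsTo_surface x hx), one_pow]
    change definingFunction Φ (u z) ≤ definingFunction Φ (u x)
    rw [h1]
    exact definingFunction_le_one (hu.mapsTo_closure z hz)
  have hd : HasFDerivWithinAt (definingFunction Φ ∘ u)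
      ((fderiv ℝ (definingFunction Φ) (u x)).comp (fderivWithin ℝ u disk x)) disk x :=
    (((contDiff_definingFunction Φ).differentiable (by simp) _).hasFDerivAt).comp_hasFDerivWithinAt
      x (hu.smooth.differentiableOn (by simp) x hxd).hasFDerivWithinAt
  have hcone : -x ∈ posTangentConeAt disk x := by
    refine mem_posTangentConeAt_of_segment_subset ?_
    rw [add_neg_cancel]
    exact (convex_closedBall (0 : ℂ) 1).segment_subset hxd (by simp)
  have h := hmax.hasFDerivWithinAt_nonpos hd hcone
  rw [map_neg] at h
  rw [inner_gradient_definingFunction]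
  exact neg_nonpos.1 h

/-- By strict convexity the boundary term of the form has a sign: at a boundary point the normal
of `u` is tangent to the surface, and the radial derivative is an outward normal. -/
theorem boundaryCoefficient_nonpos {Φ : Diffeo3} (hΦ : IsStrictlyConvex Φ) {H : ℝ} {u : ℂ → E3}
    (hu : IsFreeBoundaryCMCDisk Φ H u) {x : ℂ} (hx : x ∈ sphere (0 : ℂ) 1) :
    secondFundamentalFormDir Φ (u x) (radialDeriv u x) (unitNormal u x) (unitNormal u x) ≤ 0 := by
  have hy := hu.mapsTo_surface x hx
  have hge := inner_gradient_radialDeriv_nonneg hu hx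
  have horth := hu.orthogonal x hx
  have hn := inner_radialDeriv_unitNormal u x
  rw [secondFundamentalFormDir]
  generalize unitNormal u x = n at *
  generalize radialDeriv u x = w at *
  have hmem : ∀ v, inner ℝ (gradient (definingFunction Φ) (u x)) v = 0 →
      v ∈ tangentPlane Φ (u x) := fun v => mem_tangentPlane_of_inner_gradient_eq_zero
  have hη : inwardNormal Φ (u x) = -(‖gradient (definingFunction Φ) (u x)‖⁻¹ •
    gradient (definingFunction Φ) (u x)) := rfl
  set g := gradient (definingFunction Φ) (u x)
  have hle : inner ℝ w (inwardNormal Φ (u x)) ≤ 0 := by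
    rw [hη, inner_neg_right, real_inner_smul_right, real_inner_comm]
    have : 0 ≤ ‖g‖⁻¹ * inner ℝ g w := by positivity
    linarith
  by_cases hw : w = 0
  · simp [hw]
  refine mul_nonpos_of_nonpos_of_nonneg hle ?_
  by_cases hn0 : n = 0
  · simp [hn0, secondFundamentalForm]
  refine (hΦ (u x) hy n (hmem n ?_) hn0).le
  -- `w` is a nonzero multiple of `g`, because it is orthogonal to the plane `gᗮ`.
  have hwg : w ∈ ℝ ∙ g := by
    rw [← Submodule.orthogonal_orthogonal (ℝ ∙ g), Submodule.mem_orthogonal]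
    intro v hv
    rw [real_inner_comm]
    exact horth v (hmem v ((Submodule.mem_orthogonal_singleton_iff_inner_right).1 hv))
  obtain ⟨a, rfl⟩ := Submodule.mem_span_singleton.1 hwg
  rw [real_inner_smul_left] at hn
  exact (mul_eq_zero.1 hn).resolve_left fun ha => hw (by rw [ha, zero_smul])

/-- The boundary coefficient `A^{u_r}(n, n)` of the form as a function of the angle. -/
noncomputable def boundaryCoefficient (Φ : Diffeo3) (u : ℂ → E3) (θ : ℝ) : ℝ :=
  secondFundamentalFormDir Φ (u (circleMap 0 1 θ)) (radialDeriv u (circleMap 0 1 θ))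
    (unitNormal u (circleMap 0 1 θ)) (unitNormal u (circleMap 0 1 θ))

theorem circleMap_mem_disk (θ : ℝ) : circleMap 0 1 θ ∈ disk :=
  sphere_subset_closedBall (circleMap_mem_sphere 0 zero_le_one θ)

/-- The boundary coefficient may be discontinuous at branch points, where the unit normal is, but
it is measurable and dominated by a continuous function. -/
theorem measurable_boundaryCoefficient_and_bound {Φ : Diffeo3} {H : ℝ} {u : ℂ → E3}
    (hu : IsFreeBoundaryCMCDisk Φ H u) :
    Measurable (boundaryCoefficient Φ u) ∧
      ∃ C : ℝ → ℝ, Continuous C ∧ ∀ θ, |boundaryCoefficient Φ u θ| ≤ C θ := by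
  have hres : ∀ {F : Type} [TopologicalSpace F] {g : ℂ → F}, ContinuousOn g disk →
      Continuous fun θ => g (circleMap 0 1 θ) := fun hg =>
    hg.comp_continuous (continuous_circleMap 0 1) circleMap_mem_disk
  have hsurf : ∀ θ, u (circleMap 0 1 θ) ∈ surface Φ := fun θ =>
    hu.mapsTo_surface _ (circleMap_mem_sphere 0 zero_le_one θ)
  have hU : Continuous fun θ => u (circleMap 0 1 θ) := hres hu.smooth.continuousOn
  have hη : Continuous fun θ => inwardNormal Φ (u (circleMap 0 1 θ)) :=
    continuous_iff_continuousAt.2 fun θ =>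
      ContinuousAt.comp (f := fun θ => u (circleMap 0 1 θ))
        (contDiffAt_inwardNormal (hsurf θ)).continuousAt hU.continuousAt
  have hDη : Continuous fun θ => fderiv ℝ (inwardNormal Φ) (u (circleMap 0 1 θ)) :=
    continuous_iff_continuousAt.2 fun θ =>
      ContinuousAt.comp (f := fun θ => u (circleMap 0 1 θ))
        ((contDiffAt_inwardNormal (hsurf θ)).continuousAt_fderiv one_ne_zero) hU.continuousAt
  have hr : Continuous fun θ => radialDeriv u (circleMap 0 1 θ) :=
    hres (continuousOn_dirDeriv hu.smooth continuous_id)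
  have hw : Continuous fun θ =>
      cross (partial₁ u (circleMap 0 1 θ)) (partial₂ u (circleMap 0 1 θ)) :=
    continuous_cross.comp ((hres (continuousOn_dirDeriv hu.smooth continuous_const)).prodMk
      (hres (continuousOn_dirDeriv hu.smooth continuous_const)))
  have hrη := hr.inner hη (𝕜 := ℝ)
  have hkey : ∀ θ, boundaryCoefficient Φ u θ =
      inner ℝ (radialDeriv u (circleMap 0 1 θ)) (inwardNormal Φ (u (circleMap 0 1 θ))) *
      ((‖cross (partial₁ u (circleMap 0 1 θ)) (partial₂ u (circleMap 0 1 θ))‖⁻¹) ^ 2 *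
        -inner ℝ (fderiv ℝ (inwardNormal Φ) (u (circleMap 0 1 θ))
          (cross (partial₁ u (circleMap 0 1 θ)) (partial₂ u (circleMap 0 1 θ))))
          (cross (partial₁ u (circleMap 0 1 θ)) (partial₂ u (circleMap 0 1 θ)))) := by
    intro θ
    simp only [boundaryCoefficient, secondFundamentalFormDir, secondFundamentalForm, unitNormal,
      map_smul, real_inner_smul_left, real_inner_smul_right]
    ring
  refine ⟨?_, fun θ => |inner ℝ (radialDeriv u (circleMap 0 1 θ))
    (inwardNormal Φ (u (circleMap 0 1 θ)))| *
      ‖fderiv ℝ (inwardNormal Φ) (u (circleMap 0 1 θ))‖, hrη.abs.mul hDη.norm, fun θ => ?_⟩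
  · rw [funext hkey]
    exact hrη.measurable.mul ((hw.norm.measurable.inv.pow_const 2).mul
      ((hDη.clm_apply hw).inner hw (𝕜 := ℝ)).neg.measurable)
  · rw [hkey, abs_mul]
    refine mul_le_mul_of_nonneg_left ?_ (abs_nonneg _)
    rw [abs_mul, abs_neg, abs_of_nonneg (by positivity)]
    set w := cross (partial₁ u (circleMap 0 1 θ)) (partial₂ u (circleMap 0 1 θ))
    set A := fderiv ℝ (inwardNormal Φ) (u (circleMap 0 1 θ))
    calc (‖w‖⁻¹) ^ 2 * |inner ℝ (A w) w| ≤ (‖w‖⁻¹) ^ 2 * (‖A‖ * ‖w‖ * ‖w‖) := by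
          gcongr
          exact (abs_real_inner_le_norm _ _).trans (by gcongr; exact A.le_opNorm w)
      _ = ‖A‖ * (‖w‖⁻¹ * ‖w‖) ^ 2 := by ring
      _ ≤ ‖A‖ * 1 ^ 2 := by
          gcongr
          exact inv_mul_le_one
      _ = ‖A‖ := by ring

/-! ### The form as an energy minus a measure, and its negative directions -/

/-- The part of the index measure that lives in the interior of the disk, with density
`(|∇u|² / 2) (H² / 2)`. -/
noncomputable def interiorMeasure (H : ℝ) (u : ℂ → E3) : Measure ℂ :=
  (volume.restrict (ball 0 1)).withDensity fun x =>
    ENNReal.ofReal (gradSq u x / 2 * (H ^ 2 / 2))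

/-- The part of the index measure that lives on the unit circle, with density `-A^{u_r}(n, n)` with
respect to arc length. -/
noncomputable def boundaryMeasure (Φ : Diffeo3) (u : ℂ → E3) : Measure ℂ :=
  ((volume.restrict (Ioc 0 (2 * Real.pi))).withDensity fun θ =>
    ENNReal.ofReal (-boundaryCoefficient Φ u θ)).map (circleMap 0 1)

/-- The positive measure `ν` on the closed disk for which the form of the theorem is
`∫_B |∇f|² - ∫ f² dν`. -/
noncomputable def indexMeasure (Φ : Diffeo3) (H : ℝ) (u : ℂ → E3) : Measure ℂ :=
  interiorMeasure H u + boundaryMeasure Φ u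

theorem gradSq_nonneg {F : Type*} [NormedAddCommGroup F] [InnerProductSpace ℝ F]
    (u : ℂ → F) (x : ℂ) : 0 ≤ gradSq u x := by
  unfold gradSq; positivity

theorem integrableOn_ball_of_continuousOn_disk {g : ℂ → ℝ} (hg : ContinuousOn g disk) :
    IntegrableOn g (ball 0 1) :=
  (hg.integrableOn_compact (isCompact_closedBall 0 1)).mono_set ball_subset_closedBall

section IndexMeasure

variable {Φ : Diffeo3} {H : ℝ} {u : ℂ → E3}

theorem integrableOn_interiorDensity (hu : IsFreeBoundaryCMCDisk Φ H u) :
    IntegrableOn (fun x => gradSq u x / 2 * (H ^ 2 / 2)) (ball 0 1) :=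
  integrableOn_ball_of_continuousOn_disk
    (((continuousOn_gradSq hu.smooth).div_const 2).mul_const _)

theorem integrableOn_boundaryCoefficient (hu : IsFreeBoundaryCMCDisk Φ H u) :
    IntegrableOn (boundaryCoefficient Φ u) (Ioc 0 (2 * Real.pi)) := by
  obtain ⟨hm, C, hC, hle⟩ := measurable_boundaryCoefficient_and_bound hu
  exact (hC.integrableOn_Ioc).mono' hm.aestronglyMeasurable (ae_of_all _ hle)

theorem isFiniteMeasure_interiorMeasure (hu : IsFreeBoundaryCMCDisk Φ H u) :
    IsFiniteMeasure (interiorMeasure H u) :=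
  isFiniteMeasure_withDensity_ofReal (integrableOn_interiorDensity hu).2

theorem isFiniteMeasure_boundaryMeasure (hu : IsFreeBoundaryCMCDisk Φ H u) :
    IsFiniteMeasure (boundaryMeasure Φ u) := by
  have := isFiniteMeasure_withDensity_ofReal (integrableOn_boundaryCoefficient hu).neg.2
  exact Measure.isFiniteMeasure_map _ _

theorem isFiniteMeasure_indexMeasure (hu : IsFreeBoundaryCMCDisk Φ H u) :
    IsFiniteMeasure (indexMeasure Φ H u) := by
  have := isFiniteMeasure_interiorMeasure hu
  have := isFiniteMeasure_boundaryMeasure hu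
  unfold indexMeasure
  infer_instance

theorem ae_interiorMeasure_mem_disk (H : ℝ) (u : ℂ → E3) :
    ∀ᵐ z ∂interiorMeasure H u, z ∈ disk :=
  (withDensity_absolutelyContinuous _ _).ae_le
    ((ae_restrict_mem measurableSet_ball).mono fun _ hz => ball_subset_closedBall hz)

theorem ae_boundaryMeasure_mem_disk (Φ : Diffeo3) (u : ℂ → E3) :
    ∀ᵐ z ∂boundaryMeasure Φ u, z ∈ disk :=
  (ae_map_iff (continuous_circleMap 0 1).aemeasurable measurableSet_closedBall).2
    (ae_of_all _ circleMap_mem_disk)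

theorem ae_indexMeasure_mem_disk (Φ : Diffeo3) (H : ℝ) (u : ℂ → E3) :
    ∀ᵐ z ∂indexMeasure Φ H u, z ∈ disk := by
  rw [indexMeasure, ae_add_measure_iff]
  exact ⟨ae_interiorMeasure_mem_disk H u, ae_boundaryMeasure_mem_disk Φ u⟩

instance nullSingletonClass_indexMeasure : NullSingletonClass (indexMeasure Φ H u) where
  measure_singleton z := by
    have h1 : interiorMeasure H u {z} = 0 := withDensity_absolutelyContinuous _ _ (by simp)
    have h2 : boundaryMeasure Φ u {z} = 0 := by
      rw [boundaryMeasure, Measure.map_apply (continuous_circleMap 0 1).measurable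
        (measurableSet_singleton z)]
      exact withDensity_absolutelyContinuous _ _
        (((countable_singleton z).preimage_circleMap 0 one_ne_zero).measure_zero _)
    rw [indexMeasure, Measure.add_apply, h1, h2, add_zero]

theorem integral_indexMeasure (hΦ : IsStrictlyConvex Φ) (hu : IsFreeBoundaryCMCDisk Φ H u)
    {g : ℂ → ℝ} (hg : Continuous g) :
    ∫ z, g z ∂indexMeasure Φ H u =
      (∫ x in ball (0 : ℂ) 1, g x * (gradSq u x / 2) * (H ^ 2 / 2)) -
        ∫ θ in (0 : ℝ)..(2 * Real.pi), g (circleMap 0 1 θ) * boundaryCoefficient Φ u θ := by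
  have := isFiniteMeasure_interiorMeasure hu
  have := isFiniteMeasure_boundaryMeasure hu
  rw [indexMeasure, integral_add_measure
    (integrable_of_continuous_of_disk (ae_interiorMeasure_mem_disk H u) hg)
    (integrable_of_continuous_of_disk (ae_boundaryMeasure_mem_disk Φ u) hg), sub_eq_add_neg]
  congr 1
  · rw [interiorMeasure, integral_withDensity_eq_integral_toReal_smul₀
      (integrableOn_interiorDensity hu).1.aemeasurable.ennreal_ofReal
      (ae_of_all _ fun _ => ENNReal.ofReal_lt_top)]
    refine integral_congr_ae (ae_of_all _ fun x => ?_)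
    have := gradSq_nonneg u x
    simp only
    rw [ENNReal.toReal_ofReal (by positivity), smul_eq_mul]
    ring
  · have hk : Measurable fun θ => -boundaryCoefficient Φ u θ :=
      (measurable_boundaryCoefficient_and_bound hu).1.neg
    rw [boundaryMeasure, integral_map (continuous_circleMap 0 1).aemeasurable
      hg.aestronglyMeasurable, integral_withDensity_eq_integral_toReal_smul₀
      hk.aemeasurable.ennreal_ofReal
      (ae_of_all _ fun _ => ENNReal.ofReal_lt_top),
      intervalIntegral.integral_of_le (by positivity), ← integral_neg]
    refine integral_congr_ae (ae_of_all _ fun θ => ?_)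
    have : boundaryCoefficient Φ u θ ≤ 0 :=
      boundaryCoefficient_nonpos hΦ hu (circleMap_mem_sphere 0 zero_le_one θ)
    simp only
    rw [ENNReal.toReal_ofReal (by linarith), smul_eq_mul]
    ring

theorem formB_eq (hΦ : IsStrictlyConvex Φ) (hu : IsFreeBoundaryCMCDisk Φ H u)
    {f : ℂ → ℝ} (hf : ContDiff ℝ ∞ f) :
    formB Φ H u f = (∫ x in ball (0 : ℂ) 1, gradSq f x) - ∫ z, f z ^ 2 ∂indexMeasure Φ H u := by
  have hsq : Continuous fun z => f z ^ 2 := hf.continuous.pow 2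
  rw [integral_indexMeasure hΦ hu hsq, formB, integral_sub]
  · simp only [boundaryCoefficient]
    ring
  · exact integrableOn_ball_of_continuousOn_disk (continuousOn_gradSq hf.contDiffOn)
  · exact integrableOn_ball_of_continuousOn_disk
      ((hsq.continuousOn.mul
        ((continuousOn_gradSq hu.smooth).div_const 2)).mul_const _)

theorem gradSq_affine {f : ℂ → ℝ} (hf : ContDiff ℝ ∞ f) (a b : ℝ) {x : ℂ} (hx : x ∈ disk) :
    gradSq (fun z => a + b * f z) x = b ^ 2 * gradSq f x := by
  have h : HasFDerivAt f (fderiv ℝ f x) x := (hf.differentiable (by simp) x).hasFDerivAt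
  rw [gradSq_eq hx ((h.const_mul b).const_add a), gradSq_eq hx h]
  simp
  ring

/-- Functions of mean zero for `ν` are orthogonal to the constants for the form. -/
theorem formB_affine (hΦ : IsStrictlyConvex Φ) (hu : IsFreeBoundaryCMCDisk Φ H u)
    {f : ℂ → ℝ} (hf : ContDiff ℝ ∞ f) (h0 : ∫ z, f z ∂indexMeasure Φ H u = 0) (a b : ℝ) :
    formB Φ H u (fun z => a + b * f z) =
      b ^ 2 * formB Φ H u f - a ^ 2 * (indexMeasure Φ H u).real univ := by
  have := isFiniteMeasure_indexMeasure hu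
  have hint : ∀ {g : ℂ → ℝ}, Continuous g → Integrable g (indexMeasure Φ H u) := fun hg =>
    integrable_of_continuous_of_disk (ae_indexMeasure_mem_disk Φ H u) hg
  have hsq : ∫ z, (a + b * f z) ^ 2 ∂indexMeasure Φ H u =
      a ^ 2 * (indexMeasure Φ H u).real univ + b ^ 2 * ∫ z, f z ^ 2 ∂indexMeasure Φ H u := by
    have hexp : ∀ z, (a + b * f z) ^ 2 = a ^ 2 + (2 * a * b * f z + b ^ 2 * f z ^ 2) :=
      fun z => by ring
    simp only [hexp]
    have h1 : Integrable (fun z => 2 * a * b * f z) (indexMeasure Φ H u) :=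
      (hint hf.continuous).const_mul _
    have h2 : Integrable (fun z => b ^ 2 * f z ^ 2) (indexMeasure Φ H u) :=
      (hint (g := fun z => f z ^ 2) (hf.continuous.pow 2)).const_mul _
    have h12 : Integrable (fun z => 2 * a * b * f z + b ^ 2 * f z ^ 2) (indexMeasure Φ H u) :=
      h1.add h2
    rw [integral_add (integrable_const _) h12, integral_add h1 h2,
      integral_const_mul, integral_const_mul, h0, integral_const, smul_eq_mul]
    ring
  rw [formB_eq hΦ hu (contDiff_const.add (contDiff_const.mul hf)), formB_eq hΦ hu hf, hsq,
    setIntegral_congr_fun measurableSet_ball fun x hx =>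
      gradSq_affine hf a b (ball_subset_closedBall hx), integral_const_mul]
  ring

/-- If the index is at most one, the form is nonnegative on the functions of mean zero: the
constants already span a negative line. -/
theorem formB_nonneg_of_integral_eq_zero (hΦ : IsStrictlyConvex Φ)
    (hu : IsFreeBoundaryCMCDisk Φ H u) (hindex : indexB Φ H u ≤ 1)
    (hm : 0 < (indexMeasure Φ H u).real univ)
    {f : ℂ → ℝ} (hf : ContDiff ℝ ∞ f) (h0 : ∫ z, f z ∂indexMeasure Φ H u = 0) :
    0 ≤ formB Φ H u f := by
  by_contra! hneg
  let L : ℝ × ℝ →ₗ[ℝ] (ℂ → ℝ) :=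
    (LinearMap.toSpanSingleton ℝ (ℂ → ℝ) 1).coprod (LinearMap.toSpanSingleton ℝ (ℂ → ℝ) f)
  have hL : ∀ p, L p = fun z => p.1 + p.2 * f z := by
    intro p
    funext z
    simp [L]
  have hlt : ∀ p, p ≠ 0 → formB Φ H u (L p) < 0 := by
    rintro ⟨a, b⟩ hp
    rw [hL, formB_affine hΦ hu hf h0]
    by_cases hb : b = 0
    · have ha : a ≠ 0 := fun ha => hp (by rw [ha, hb]; rfl)
      have : 0 < a ^ 2 := by positivity
      simp only [hb]
      nlinarith
    · have : 0 < b ^ 2 := by positivity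
      simp only
      nlinarith [mul_nonneg (sq_nonneg a) hm.le]
  have hinj : Function.Injective L := by
    refine (injective_iff_map_eq_zero L).2 fun p hp => ?_
    by_contra hp0
    have h := hlt p hp0
    have hz := formB_affine hΦ hu hf h0 0 0
    rw [← hL (0, 0), show ((0, 0) : ℝ × ℝ) = 0 from rfl, map_zero] at hz
    rw [hp, hz] at h
    norm_num at h
  have hW : IsNegativeSpace Φ H u (LinearMap.range L) := by
    constructor
    · rintro _ ⟨p, rfl⟩
      rw [hL]
      exact (contDiff_const.add (contDiff_const.mul hf)).contDiffOn
    · rintro _ ⟨p, rfl⟩ hp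
      exact hlt p fun h => hp (by rw [h, map_zero])
  have h2 : Cardinal.toENat (Module.rank ℝ (LinearMap.range L)) ≤ 1 :=
    (le_iSup₂ (f := fun (W : Submodule ℝ (ℂ → ℝ)) (_ : IsNegativeSpace Φ H u W) =>
      Cardinal.toENat (Module.rank ℝ W)) _ hW).trans hindex
  rw [rank_range_of_injective L hinj, rank_prod', Module.rank_self, one_add_one_eq_two] at h2
  norm_num at h2

/-- Hersch's argument: testing with the components of a conformal map into the sphere that balances
the index measure bounds its total mass by the energy `8π` of the sphere. -/
theorem indexMeasure_real_univ_le (hΦ : IsStrictlyConvex Φ)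
    (hu : IsFreeBoundaryCMCDisk Φ H u) (hindex : indexB Φ H u ≤ 1) :
    (indexMeasure Φ H u).real univ ≤ 8 * Real.pi := by
  have := isFiniteMeasure_indexMeasure hu
  have hν := ae_indexMeasure_mem_disk Φ H u
  rcases (measureReal_nonneg (μ := indexMeasure Φ H u) (s := univ)).eq_or_lt with hm | hm
  · rw [← hm]
    positivity
  obtain ⟨c, s, hs, hbar⟩ := exists_conformal_barycenter hν hm
  have hsum : 0 ≤ ∑ i, formB Φ H u (stereo c s i) := Finset.sum_nonneg fun i _ =>
    formB_nonneg_of_integral_eq_zero hΦ hu hindex hm (contDiff_stereo hs c i) (hbar i)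
  have hsq : ∀ i, Continuous fun z => stereo c s i z ^ 2 := fun i =>
    (contDiff_stereo hs c i).continuous.pow 2
  simp only [fun i => formB_eq hΦ hu (contDiff_stereo hs c i), Finset.sum_sub_distrib] at hsum
  rw [← integral_finsetSum _ fun i _ => integrableOn_ball_of_continuousOn_disk
      (continuousOn_gradSq (contDiff_stereo hs c i).contDiffOn),
    ← integral_finsetSum _ fun i _ => integrable_of_continuous_of_disk hν (hsq i)] at hsum
  simp only [sum_stereo_sq hs c, integral_const, smul_eq_mul, mul_one] at hsum
  linarith [integral_sum_gradSq_stereo_le hs c]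

theorem dirichletEnergy_mul_le (hΦ : IsStrictlyConvex Φ) (hu : IsFreeBoundaryCMCDisk Φ H u) :
    dirichletEnergy u * (H ^ 2 / 2) ≤ (indexMeasure Φ H u).real univ := by
  have := isFiniteMeasure_indexMeasure hu
  have h := integral_indexMeasure hΦ hu (continuous_const (y := (1 : ℝ)))
  simp only [integral_const, smul_eq_mul, mul_one, one_mul, integral_mul_const] at h
  have hb : ∫ θ in (0 : ℝ)..(2 * Real.pi), boundaryCoefficient Φ u θ ≤ 0 := by
    rw [intervalIntegral.integral_of_le (by positivity)]
    exact integral_nonpos fun θ =>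
      boundaryCoefficient_nonpos hΦ hu (circleMap_mem_sphere 0 zero_le_one θ)
  rw [h, dirichletEnergy]
  linarith

end IndexMeasure

end FreeBoundaryCMC

theorem proposition7p3 (Φ : FreeBoundaryCMC.Diffeo3) (hΦ : FreeBoundaryCMC.IsStrictlyConvex Φ)
    (H : ℝ) (hH : 0 < H) (u : ℂ → FreeBoundaryCMC.E3)
    (hu : FreeBoundaryCMC.IsFreeBoundaryCMCDisk Φ H u)
    (hindex : FreeBoundaryCMC.indexB Φ H u ≤ 1) :
    FreeBoundaryCMC.dirichletEnergy u ≤ 16 * Real.pi / H ^ 2 := by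
  have h := (FreeBoundaryCMC.dirichletEnergy_mul_le hΦ hu).trans
    (FreeBoundaryCMC.indexMeasure_real_univ_le hΦ hu hindex)
  rw [le_div_iff₀ (by positivity)]
  linarith
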